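/- **Setting.** Let a group $\Gamma$ act on a countable set $V$ with finitely many orbits, and let $\mu$ be a finite measure on the (finite, discrete) set of orbits. For a $\Gamma$-invariant $\varphi\colon V\to[0,\infty]$ write $\mathbb E_{\mu(o)}\,\varphi(o)=\sum_{c}\mu(c)\,\varphi(o_c)$, where $c$ runs over the orbits and $o_c$ is any point of $c$. Assume the Mass-Transport Principle with respect to $\mu$: for every $f\colon V\times V\to[0,\infty]$ with $f(\gamma u,\gamma v)=f(u,v)$ for all $\gamma\in\Gamma$, $u,v\in V$, $$\mathbb E_{\mu(o)}\sum_{v\in V}f(o,v)=\mathbb E_{\mu(o)}\sum_{v\in V}f(v,o).$$ To every subset $U\subseteq V$ let a weight $\alpha_U\in[0,\infty)$ be assigned such that $\alpha_{\gamma U}=\alpha_U$ for all $\gamma\in\Gamma$; $\alpha_U=0$ if $U$ is infinite; and for each $v\in V$ there are only finitely many $U\ni v$ with $\alpha_U\neq0$. Let $Z_u$, $u\in V$, be independent random variables, each uniformly distributed on $[0,1]$. Let $M$ be a finite set, let $F\colon[0,1]^V\to M^V$ be measurable and $\Gamma$-equivariant (for the actions $(\gamma z)_v=z_{\gamma^{-1}v}$),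 and let $(X_v)_{v\in V}=F\big((Z_u)_{u\in V}\big)$. Suppose that for each $u\in V$ there is a given finite set $W_u\subseteq V$ such that $Z_u$ influences only the labels at the elements of $W_u$: if $z,z'\in[0,1]^V$ differ at most in the coordinate $u$, then $F(z)_v=F(z')_v$ for all $v\notin W_u$. For finite $U\subseteq V$ let $H(X_U)$ be the Shannon entropy of $X_U=(X_v)_{v\in U}$, where a random variable taking finitely many values with probabilities $p_1,\dots,p_m$ has entropy $-\sum_i p_i\log p_i$; write $H(X_o)$ for $H(X_{\{o\}})$. **Theorem 3.3.** Under these assumptions $$\mathbb E_{\mu(o)}\sum_{U:\,o\in U}\frac{\alpha_U}{|U|}\,H(X_U)\;\ge\;\beta\;\mathbb E_{\mu(o)}\,H(X_o),\qquad\text{where}\quad \beta=\inf_{u\in V;\ \emptyset\ne W\subseteq W_u}\ \frac{\sum_{U\subseteq V:\,U\cap W\neq\emptyset}\alpha_U}{|W|}.$$ Terms with $\alpha_U=0$ are $0$. If all $W_u$ are empty, then $\beta=+\infty$, and the product with $\mathbb E_{\mu(o)}H(X_o)$ is read with $\infty\cdot0=0$. -/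

import Mathlib

open MeasureTheory ProbabilityTheory
open scoped ENNReal NNReal Pointwise

noncomputable section

namespace EntropyExpansion

/-- The mean `E_{μ(o)} φ(o)` of a nonnegative function `φ` on `V` with respect to a measure `μ`
on the set of orbits. One point `o` is taken from each orbit; for the `Γ`-invariant functions `φ`
to which this is applied the choice does not matter, see `orbitMean_eq_of_section`. -/
def orbitMean {Γ V : Type*} [Group Γ] [MulAction Γ V]
    [MeasurableSpace (MulAction.orbitRel.Quotient Γ V)]
    (μ : Measure (MulAction.orbitRel.Quotient Γ V)) (φ : V → ℝ≥0∞) : ℝ≥0∞ :=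
  ∫⁻ c, φ (Quotient.out c) ∂μ

theorem orbitMean_eq_of_section {Γ V : Type*} [Group Γ] [MulAction Γ V]
    [MeasurableSpace (MulAction.orbitRel.Quotient Γ V)]
    (μ : Measure (MulAction.orbitRel.Quotient Γ V)) (φ : V → ℝ≥0∞)
    (hφ : ∀ (γ : Γ) (v : V), φ (γ • v) = φ v)
    (s : MulAction.orbitRel.Quotient Γ V → V)
    (hs : ∀ c, (Quotient.mk _ (s c) : MulAction.orbitRel.Quotient Γ V) = c) :
    orbitMean μ φ = ∫⁻ c, φ (s c) ∂μ := by
  refine lintegral_congr fun c => ?_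
  have h : (MulAction.orbitRel Γ V) (Quotient.out c) (s c) :=
    Quotient.exact ((Quotient.out_eq c).trans (hs c).symm)
  rw [MulAction.orbitRel_apply] at h
  obtain ⟨γ, hγ⟩ := h
  simp only at hγ
  rw [← hγ, hφ]

/-- A function on `V × V` is diagonally invariant if `f (γ u) (γ v) = f u v`. -/
def DiagonallyInvariant (Γ : Type*) {V : Type*} [Group Γ] [MulAction Γ V]
    (f : V → V → ℝ≥0∞) : Prop :=
  ∀ (γ : Γ) (u v : V), f (γ • u) (γ • v) = f u v

/-- The Mass-Transport Principle for the action of `Γ` on `V`, with respect to a measure on the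
set of orbits. -/
def MassTransportPrinciple {Γ V : Type*} [Group Γ] [MulAction Γ V]
    [MeasurableSpace (MulAction.orbitRel.Quotient Γ V)]
    (μ : Measure (MulAction.orbitRel.Quotient Γ V)) : Prop :=
  ∀ f : V → V → ℝ≥0∞, DiagonallyInvariant Γ f →
    orbitMean μ (fun o => ∑' v, f o v) = orbitMean μ (fun o => ∑' v, f v o)

/-- The conditions on the nonnegative weights `α U`, `U ⊆ V`. -/
structure IsInvariantWeight (Γ : Type*) {V : Type*} [Group Γ] [MulAction Γ V]
    (α : Set V → ℝ≥0) : Prop where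
  invariant : ∀ (γ : Γ) (U : Set V), α (γ • U) = α U
  finite_of_ne_zero : ∀ U : Set V, α U ≠ 0 → U.Finite
  locally_finite : ∀ v : V, {U : Set V | v ∈ U ∧ α U ≠ 0}.Finite

/-- An IID process: independent random variables, each uniformly distributed on `[0,1]`. -/
structure IsIIDProcess {V Ω : Type*} [MeasurableSpace Ω] (P : Measure Ω)
    (Z : V → Ω → unitInterval) : Prop where
  measurable : ∀ u, Measurable (Z u)
  indep : iIndepFun Z P
  uniform : ∀ u, P.map (Z u) = volume

/-- The left action of `Γ` on labellings of `V`. -/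
def shift {Γ V S : Type*} [Group Γ] [MulAction Γ V] (γ : Γ) (z : V → S) : V → S :=
  fun v => z (γ⁻¹ • v)

/-- A factor map: a measurable `Γ`-equivariant map `[0,1]^V → M^V`. -/
structure IsFactorMap (Γ : Type*) {V M : Type*} [Group Γ] [MulAction Γ V] [MeasurableSpace M]
    (F : (V → unitInterval) → (V → M)) : Prop where
  measurable : Measurable F
  equivariant : ∀ (γ : Γ) (z : V → unitInterval), F (shift γ z) = shift γ (F z)

/-- Under the map `F`, the seed at `u` influences only the labels at the vertices of `A`:
changing the seed at `u` alone leaves every label outside `A` unchanged. -/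
def InfluencesOnly {V S M : Type*} (F : (V → S) → (V → M)) (u : V) (A : Set V) : Prop :=
  ∀ z z' : V → S, (∀ w, w ≠ u → z w = z' w) → ∀ v, v ∉ A → F z v = F z' v

/-- Shannon entropy `∑ₛ -p(s) log p(s)`, with `p(s) = P(Y = s)`, of a random variable `Y` that
takes values in a finite set. (The terms are nonnegative.) -/
def entropy {Ω S : Type*} [MeasurableSpace Ω] (P : Measure Ω) (Y : Ω → S) : ℝ≥0∞ :=
  ∑' s : S, ENNReal.ofReal (Real.negMulLog (P.real (Y ⁻¹' {s})))

/-- The infimum over `u` and nonempty `A ⊆ W u` of the total weight of the sets that meet `A`,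
divided by `|A|`. -/
def expansion {V : Type*} (α : Set V → ℝ≥0) (W : V → Finset V) : ℝ≥0∞ :=
  ⨅ (u : V) (A : Finset V) (_ : A ⊆ W u) (_ : A.Nonempty),
    (∑' U : {U : Set V // (U ∩ (A : Set V)).Nonempty}, (α U.1 : ℝ≥0∞)) / (A.card : ℝ≥0∞)

end EntropyExpansion

end

noncomputable section

namespace EntropyExpansion

/-! The entropy of a label is split among the seeds. Give each point an independent uniform clock
`T`, reveal the seeds in the order of the clocks, and let `info f u` be the mean drop in the
conditional entropy of `f` when seed `u` is revealed. If `f` depends almost surely on finitely many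
seeds, the drops telescope to its entropy (`tsum_info`). A fixed order of `V` need not be
`Γ`-invariant; the law of the random order is, so `info` is equivariant (`info_equivariant`).

Fix `u`. Put `a v = info` of the label at `v` and `b U = info` of the labels on `U`. Since seeds are
independent, passing to a function of `f` cannot increase the information (`info_comp_le`), so `a v
≤ b U` for `v ∈ U`; moreover `a` vanishes off `W u`. Slicing `a` into level sets and using the
definition of `β` on each of them gives `β ∑ a v ≤ ∑ α U * b U` (`expansion_mul_sum_le`). Mass
transport exchanges the seed and the label, and turns the mean of this inequality over `u` into the
claim.

Finite dependence has two sources: by mass transport only finitely many seeds influence a given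
label (`finite_setOf_mem_influence`), and a zero-one law excludes dependence on the tail
(`dependsAE_of_not_influenced`). -/

/-- The law of independent uniform seeds. -/
abbrev seedMeasure (V : Type*) : Measure (V → unitInterval) :=
  Measure.infinitePi fun _ => volume

open scoped Classical in
/-- The configuration that agrees with `z` on `R` and with `z'` off `R`. -/
def merge {V : Type*} (R : Set V) (z z' : V → unitInterval) : V → unitInterval :=
  fun v => if v ∈ R then z v else z' v

/-! ### Resampling the seeds off a set. -/

section Merge

variable {V : Type*}

@[simp]
theorem merge_univ (z z' : V → unitInterval) : merge Set.univ z z' = z := by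
  ext v; simp [merge]

@[simp]
theorem merge_empty (z z' : V → unitInterval) : merge ∅ z z' = z' := by
  ext v; simp [merge]

theorem measurable_merge (R : Set V) :
    Measurable fun p : (V → unitInterval) × (V → unitInterval) => merge R p.1 p.2 := by
  refine measurable_pi_lambda _ fun v => ?_
  by_cases hv : v ∈ R
  · simp only [merge, hv, if_true]; fun_prop
  · simp only [merge, hv, if_false]; fun_prop

theorem measurable_merge_right (R : Set V) (z : V → unitInterval) : Measurable (merge R z) :=
  (measurable_merge R).comp measurable_prodMk_left

theorem measurePreserving_merge (R : Set V) :
    MeasurePreserving (fun p : (V → unitInterval) × (V → unitInterval) => merge R p.1 p.2)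
      ((seedMeasure V).prod (seedMeasure V)) (seedMeasure V) := by
  classical
  refine ⟨measurable_merge R, Measure.eq_infinitePi _ fun s t ht => ?_⟩
  rw [Measure.map_apply (measurable_merge R) (.pi s.countable_toSet fun _ _ => ht _)]
  have : (fun p : (V → unitInterval) × (V → unitInterval) => merge R p.1 p.2) ⁻¹'
      ((s : Set V).pi t) = (((s.filter (· ∈ R) : Finset V) : Set V).pi t) ×ˢ
        (((s.filter (¬ · ∈ R) : Finset V) : Set V).pi t) := by
    ext ⟨z, z'⟩
    simp only [Set.mem_preimage, Set.mem_pi, Set.mem_prod, Finset.coe_filter, Set.mem_ofPred_eq,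
      merge, Finset.mem_coe]
    constructor
    · refine fun h => ⟨fun v hv => ?_, fun v hv => ?_⟩
      · simpa [hv.2] using h v hv.1
      · simpa [hv.2] using h v hv.1
    · rintro ⟨h, h'⟩ v hv
      by_cases hR : v ∈ R
      · simpa [hR] using h v ⟨hv, hR⟩
      · simpa [hR] using h' v ⟨hv, hR⟩
  rw [this, Measure.prod_prod, Measure.infinitePi_pi _ fun i _ => ht i,
    Measure.infinitePi_pi _ fun i _ => ht i, Finset.prod_filter_mul_prod_filter_not]

theorem merge_merge_of_subset {R R' : Set V} (h : R ⊆ R') (z z' z'' : V → unitInterval) :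
    merge R' (merge R z z') z'' = merge R z (merge R' z' z'') := by
  ext v
  by_cases hv : v ∈ R
  · simp [merge, hv, h hv]
  · by_cases hv' : v ∈ R' <;> simp [merge, hv, hv']

theorem integrable_comp_merge {R : Set V} {φ : (V → unitInterval) → ℝ}
    (hφ : Integrable φ (seedMeasure V)) :
    Integrable (fun p : (V → unitInterval) × (V → unitInterval) => φ (merge R p.1 p.2))
      ((seedMeasure V).prod (seedMeasure V)) :=
  (measurePreserving_merge R).integrable_comp_of_integrable hφ

theorem integral_integral_merge (R : Set V) {φ : (V → unitInterval) → ℝ}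
    (hφ : Integrable φ (seedMeasure V)) :
    ∫ z, ∫ z', φ (merge R z z') ∂seedMeasure V ∂seedMeasure V = ∫ z, φ z ∂seedMeasure V := by
  rw [← integral_prod (fun p : (V → unitInterval) × (V → unitInterval) => φ (merge R p.1 p.2))
    (integrable_comp_merge hφ)]
  have hmap := (measurePreserving_merge R).map_eq
  conv_rhs => rw [← hmap]
  refine (integral_map (measurable_merge R).aemeasurable ?_).symm
  rw [hmap]
  exact hφ.aestronglyMeasurable

end Merge

/-! ### The log-sum inequality. -/

section LogSum

theorem mul_log_sub_log_nonneg {x y : ℝ} (hx : 0 ≤ x) (hxy : x ≤ y) :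
    0 ≤ x * (Real.log y - Real.log x) := by
  rcases hx.eq_or_lt with rfl | hx
  · simp
  · exact mul_nonneg hx.le (sub_nonneg.2 (Real.log_le_log hx hxy))

theorem mul_log_sub_log_le_one {x y : ℝ} (hx : 0 ≤ x) (hxy : x ≤ y) (hy : y ≤ 1) :
    x * (Real.log y - Real.log x) ≤ 1 := by
  rcases hx.eq_or_lt with rfl | hx
  · simp
  · have h := Real.log_le_sub_one_of_pos (div_pos (hx.trans_le hxy) hx)
    rw [Real.log_div (hx.trans_le hxy).ne' hx.ne'] at h
    calc x * (Real.log y - Real.log x) ≤ x * (y / x - 1) := by gcongr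
      _ = y - x := by field_simp
      _ ≤ 1 := by linarith

variable {Ω : Type*} [MeasurableSpace Ω] {ν : Measure Ω} [IsProbabilityMeasure ν] {x y : Ω → ℝ}

theorem integrable_mul_log_sub_log (hx : Measurable x) (hy : Measurable y) (h0 : ∀ ω, 0 ≤ x ω)
    (hxy : ∀ ω, x ω ≤ y ω) (h1 : ∀ ω, y ω ≤ 1) :
    Integrable (fun ω => x ω * (Real.log (y ω) - Real.log (x ω))) ν := by
  refine Integrable.of_bound
    (hx.mul (hy.log.sub hx.log)).aestronglyMeasurable 1 (.of_forall fun ω => ?_)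
  rw [Real.norm_eq_abs, abs_of_nonneg (mul_log_sub_log_nonneg (h0 ω) (hxy ω))]
  exact mul_log_sub_log_le_one (h0 ω) (hxy ω) (h1 ω)

/-- The log-sum inequality, in integral form. -/
theorem integral_mul_log_sub_log_le (hx : Measurable x) (hy : Measurable y) (h0 : ∀ ω, 0 ≤ x ω)
    (hxy : ∀ ω, x ω ≤ y ω) (h1 : ∀ ω, y ω ≤ 1) :
    ∫ ω, x ω * (Real.log (y ω) - Real.log (x ω)) ∂ν ≤
      (∫ ω, x ω ∂ν) * (Real.log (∫ ω, y ω ∂ν) - Real.log (∫ ω, x ω ∂ν)) := by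
  have hyi : Integrable y ν := .of_bound hy.aestronglyMeasurable 1 (.of_forall fun ω => by
    rw [Real.norm_eq_abs, abs_of_nonneg ((h0 ω).trans (hxy ω))]; exact h1 ω)
  have hxi : Integrable x ν := .of_bound hx.aestronglyMeasurable 1 (.of_forall fun ω => by
    rw [Real.norm_eq_abs, abs_of_nonneg (h0 ω)]; exact (hxy ω).trans (h1 ω))
  set a := ∫ ω, x ω ∂ν with ha
  set b := ∫ ω, y ω ∂ν with hb
  have hab : a ≤ b := integral_mono hxi hyi hxy
  rcases (integral_nonneg h0 : 0 ≤ a).eq_or_lt with ha0 | ha0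
  · have : x =ᵐ[ν] 0 := (integral_eq_zero_iff_of_nonneg h0 hxi).1 ha0.symm
    rw [show a = 0 from ha0.symm, zero_mul, integral_eq_zero_of_ae]
    filter_upwards [this] with ω hω
    simp [hω]
  · have hb0 : 0 < b := ha0.trans_le hab
    -- The bound `log t ≤ t - 1` at `t = y a / (x b)`; its right side integrates to exactly `a (log
    -- b - log a)`.
    have key : ∀ ω, x ω * (Real.log (y ω) - Real.log (x ω)) ≤
        x ω * (Real.log b - Real.log a - 1) + y ω * (a / b) := fun ω => by
      rcases (h0 ω).eq_or_lt with hω | hω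
      · rw [← hω]
        have := mul_nonneg ((h0 ω).trans (hxy ω)) (div_pos ha0 hb0).le
        simpa using this
      · have hyω := hω.trans_le (hxy ω)
        have h := Real.log_le_sub_one_of_pos (div_pos (mul_pos hyω ha0) (mul_pos hω hb0))
        rw [Real.log_div (mul_pos hyω ha0).ne' (mul_pos hω hb0).ne',
          Real.log_mul hyω.ne' ha0.ne', Real.log_mul hω.ne' hb0.ne'] at h
        have h2 : x ω * (y ω * a / (x ω * b)) = y ω * (a / b) := by field_simp
        nlinarith [mul_le_mul_of_nonneg_left h hω.le]
    calc ∫ ω, x ω * (Real.log (y ω) - Real.log (x ω)) ∂ν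
        ≤ ∫ ω, (x ω * (Real.log b - Real.log a - 1) + y ω * (a / b)) ∂ν :=
          integral_mono (integrable_mul_log_sub_log hx hy h0 hxy h1)
            ((hxi.mul_const _).add (hyi.mul_const _)) key
      _ = a * (Real.log b - Real.log a - 1) + b * (a / b) := by
          rw [integral_add (hxi.mul_const _) (hyi.mul_const _), integral_mul_const,
            integral_mul_const]
      _ = a * (Real.log b - Real.log a) := by field_simp; ring

end LogSum

/-! ### Conditional entropy given a set of seeds. -/

section CondEnt

variable {V K J : Type*}

/-- The conditional probability of `f = k` given the seeds in `R`. -/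
def condProb (f : (V → unitInterval) → K) (R : Set V) (z : V → unitInterval) (k : K) : ℝ :=
  (seedMeasure V).real {z' | f (merge R z z') = k}

/-- The conditional entropy of `f` given the seeds in `R`. -/
def condEnt (f : (V → unitInterval) → K) (R : Set V) : ℝ :=
  ∫ z, ∑' k, Real.negMulLog (condProb f R z k) ∂seedMeasure V

variable {f : (V → unitInterval) → K} (R : Set V)

theorem condProb_nonneg (z : V → unitInterval) (k : K) : 0 ≤ condProb f R z k :=
  measureReal_nonneg

theorem condProb_le_one (z : V → unitInterval) (k : K) : condProb f R z k ≤ 1 :=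
  measureReal_le_one

theorem measurable_condProb (hf : ∀ k, MeasurableSet (f ⁻¹' {k})) (k : K) :
    Measurable fun z => condProb f R z k :=
  (measurable_measure_prodMk_left (measurable_merge R (hf k))).ennreal_toReal

theorem condProb_le_comp (g : K → J) (z : V → unitInterval) (k : K) :
    condProb f R z k ≤ condProb (g ∘ f) R z (g k) :=
  measureReal_mono fun _ h => congrArg g h

theorem measurableSet_preimage_comp [Finite K] (hf : ∀ k, MeasurableSet (f ⁻¹' {k})) (g : K → J)
    (s : Set J) : MeasurableSet (g ∘ f ⁻¹' s) := by
  have : g ∘ f ⁻¹' s = ⋃ k ∈ g ⁻¹' s, f ⁻¹' {k} := by ext z; simp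
  rw [this]
  exact .biUnion (Set.to_countable _) fun k _ => hf k

open scoped Classical in
theorem condProb_comp_eq_sum [Fintype K] (hf : ∀ k, MeasurableSet (f ⁻¹' {k})) (g : K → J)
    (z : V → unitInterval) (j : J) :
    condProb (g ∘ f) R z j = ∑ k with g k = j, condProb f R z k := by
  unfold condProb
  rw [← measureReal_biUnion_finset]
  · congr 1
    ext z'
    simp
  · intro k _ k' _ hkk'
    exact Set.disjoint_left.2 fun z' h h' => hkk' (h.symm.trans h')
  · exact fun k _ => measurable_merge_right R z (hf k)

/-- The tower property: resampling off `R` and then off `R'` has the same effect in law as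
resampling off `R` once. -/
theorem integral_condProb_merge {R R' : Set V} (h : R ⊆ R') (hf : ∀ k, MeasurableSet (f ⁻¹' {k}))
    (z : V → unitInterval) (k : K) :
    ∫ z', condProb f R' (merge R z z') k ∂seedMeasure V = condProb f R z k := by
  have hA : MeasurableSet {w | f (merge R z w) = k} := measurable_merge_right R z (hf k)
  simp only [condProb, merge_merge_of_subset h]
  have := integral_integral_merge (V := V) R' (φ := Set.indicator {w | f (merge R z w) = k} 1)
    ((integrable_const (1 : ℝ)).indicator hA)
  rw [integral_indicator_one hA] at this
  rw [← this]
  refine integral_congr_ae (.of_forall fun z' => ?_)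
  exact (integral_indicator_one (measurable_merge_right R' z' hA)).symm

theorem integrable_negMulLog_condProb (hf : ∀ k, MeasurableSet (f ⁻¹' {k})) (k : K) :
    Integrable (fun z => Real.negMulLog (condProb f R z k)) (seedMeasure V) := by
  have := integrable_mul_log_sub_log (ν := seedMeasure V) (measurable_condProb R hf k)
    (measurable_const (a := (1 : ℝ))) (fun z => condProb_nonneg R z k)
    (fun z => condProb_le_one R z k) fun _ => le_rfl
  simpa [Real.negMulLog] using this

/-- The chain rule. -/
theorem condEnt_sub_condEnt_comp [Fintype K] (hf : ∀ k, MeasurableSet (f ⁻¹' {k})) [Finite J]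
    (g : K → J) :
    condEnt f R - condEnt (g ∘ f) R = ∫ z, ∑ k, condProb f R z k *
      (Real.log (condProb (g ∘ f) R z (g k)) - Real.log (condProb f R z k)) ∂seedMeasure V := by
  classical
  cases nonempty_fintype J
  have hgf : ∀ j, MeasurableSet (g ∘ f ⁻¹' {j}) := fun j => measurableSet_preimage_comp hf g _
  simp only [condEnt, tsum_fintype]
  rw [← integral_sub (integrable_finsetSum _ fun k _ => integrable_negMulLog_condProb R hf k)
    (integrable_finsetSum _ fun k _ => integrable_negMulLog_condProb R hgf k)]
  refine integral_congr_ae (.of_forall fun z => ?_)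
  have : ∑ j, Real.negMulLog (condProb (g ∘ f) R z j) =
      ∑ k, -(condProb f R z k * Real.log (condProb (g ∘ f) R z (g k))) := by
    rw [← Finset.sum_fiberwise Finset.univ g]
    refine Finset.sum_congr rfl fun j _ => ?_
    rw [Finset.sum_congr rfl (g := fun k => -(condProb f R z k *
      Real.log (condProb (g ∘ f) R z j))) fun k hk => by rw [(Finset.mem_filter.1 hk).2],
      Finset.sum_neg_distrib, ← Finset.sum_mul, ← condProb_comp_eq_sum R hf, Real.negMulLog,
      neg_mul]
  simp only [this]
  rw [← Finset.sum_sub_distrib]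
  exact Finset.sum_congr rfl fun k _ => by rw [Real.negMulLog]; ring

/-- Conditioning on more seeds decreases the conditional entropy of `f` given `g ∘ f`. -/
theorem condEnt_sub_condEnt_comp_anti [Finite K] [Finite J] {R R' : Set V} (h : R ⊆ R')
    (hf : ∀ k, MeasurableSet (f ⁻¹' {k})) (g : K → J) :
    condEnt f R' - condEnt (g ∘ f) R' ≤ condEnt f R - condEnt (g ∘ f) R := by
  cases nonempty_fintype K
  have hgf : ∀ j, MeasurableSet (g ∘ f ⁻¹' {j}) := fun j => measurableSet_preimage_comp hf g _
  have hint : ∀ (R : Set V) (k : K), Integrable (fun z => condProb f R z k *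
      (Real.log (condProb (g ∘ f) R z (g k)) - Real.log (condProb f R z k))) (seedMeasure V) :=
    fun R k => integrable_mul_log_sub_log (measurable_condProb R hf k)
      (measurable_condProb R hgf _) (fun z => condProb_nonneg R z k)
      (fun z => condProb_le_comp R g z k) fun z => condProb_le_one R z _
  rw [condEnt_sub_condEnt_comp R hf, condEnt_sub_condEnt_comp R' hf,
    integral_finsetSum _ fun k _ => hint R k, integral_finsetSum _ fun k _ => hint R' k]
  refine Finset.sum_le_sum fun k _ => ?_
  -- Average first over the seeds off `R`: by the tower property this turns the probabilities given
  -- `R'` into those given `R`, and the log-sum inequality applies for each fixed `z`.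
  rw [← integral_integral_merge R (hint R' k)]
  refine integral_mono (integrable_comp_merge (hint R' k)).integral_prod_left (hint R k)
    fun z => ?_
  have := integral_mul_log_sub_log_le (ν := seedMeasure V)
    ((measurable_condProb R' hf k).comp (measurable_merge_right R z))
    ((measurable_condProb R' hgf (g k)).comp (measurable_merge_right R z))
    (fun z => condProb_nonneg R' _ k) (fun z => condProb_le_comp R' g _ k)
    fun z => condProb_le_one R' _ _
  simpa only [Function.comp_apply, integral_condProb_merge h hf, integral_condProb_merge h hgf]
    using this

theorem condEnt_anti [Finite K] {R R' : Set V} (h : R ⊆ R')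
    (hf : ∀ k, MeasurableSet (f ⁻¹' {k})) : condEnt f R' ≤ condEnt f R := by
  have hc : ∀ R : Set V, condEnt ((fun _ => () : K → Unit) ∘ f) R = 0 := fun R => by
    simp [condEnt, condProb]
  simpa [hc] using condEnt_sub_condEnt_comp_anti h hf (fun _ => () : K → Unit)

end CondEnt

/-! ### From influence of single seeds to almost sure dependence. -/

section Dependence

variable {V K : Type*}

/-- Almost surely, `f` depends only on the seeds in `D`. -/
def DependsAE (f : (V → unitInterval) → K) (D : Set V) : Prop :=
  ∀ᵐ p ∂(seedMeasure V).prod (seedMeasure V), f p.1 = f (merge D p.1 p.2)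

theorem eq_of_eqOn_compl_finset {S : Type*} {f : (V → S) → K} {D : Set V}
    (h : ∀ u ∉ D, ∀ z z' : V → S, (∀ w, w ≠ u → z w = z' w) → f z = f z')
    (A : Finset V) : (∀ u ∈ A, u ∉ D) → ∀ z z' : V → S, (∀ w ∉ A, z w = z' w) → f z = f z' := by
  classical
  induction A using Finset.induction_on with
  | empty => exact fun _ z z' hz => congrArg f (funext fun w => hz w (by simp))
  | insert a A ha ih =>
    intro hA z z' hz
    rw [h a (hA a (by simp)) z (Function.update z a (z' a))
      fun w hw => (Function.update_of_ne hw _ _).symm]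
    refine ih (fun u hu => hA u (by simp [hu])) _ _ fun w hw => ?_
    by_cases hwa : w = a
    · subst hwa; simp
    · rw [Function.update_of_ne hwa]
      exact hz w (by simp [hwa, hw])

/-- A zero-one law: if no seed outside `D` influences `f`, then `f` is almost surely a function
of the seeds in `D`. -/
theorem dependsAE_of_not_influenced [Finite K] {f : (V → unitInterval) → K}
    (hf : ∀ k, MeasurableSet (f ⁻¹' {k})) {D : Set V}
    (h : ∀ u ∉ D, ∀ z z' : V → unitInterval, (∀ w, w ≠ u → z w = z' w) → f z = f z') :
    DependsAE f D := by
  classical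
  have main : ∀ k, ∀ᵐ p ∂(seedMeasure V).prod (seedMeasure V),
      f p.1 = k → f (merge D p.1 p.2) = k := by
    intro k
    rw [ae_iff, ← nonpos_iff_eq_zero]
    refine ENNReal.le_of_forall_pos_le_add fun ε hε _ => ?_
    have hε2 : (0 : ℝ≥0∞) < ε / 2 := ENNReal.div_pos (by simpa using hε.ne') (by simp)
    -- Approximate the event `B` by a cylinder over a finite `E`. Resampling only `E \ D` changes
    -- finitely many uninfluential seeds, so it keeps `B`; the cylinder cannot tell this from
    -- resampling everything off `D`. Each of the two comparisons of `B` with the cylinder costs `ε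
    -- / 2`.
    obtain ⟨C, hC, hCB⟩ := exists_measure_symmDiff_lt_of_generateFrom_isSetRing
      (μ := seedMeasure V) isSetRing_measurableCylinders
      ⟨{Set.univ}, by simp, by simpa using univ_mem_measurableCylinders fun _ : V => unitInterval, by simp⟩
      generateFrom_measurableCylinders.symm (hf k) hε2
    have hCm := MeasurableSet.of_mem_measurableCylinders hC
    obtain ⟨E, S, -, rfl⟩ := (mem_measurableCylinders C).1 hC
    set B := f ⁻¹' {k}
    have hsub : {p : (V → unitInterval) × (V → unitInterval) |
        ¬(f p.1 = k → f (merge D p.1 p.2) = k)} ⊆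
        (fun p => merge (D ∪ (E : Set V)ᶜ) p.1 p.2) ⁻¹' (symmDiff (cylinder E S) B) ∪
        (fun p => merge D p.1 p.2) ⁻¹' (symmDiff (cylinder E S) B) := by
      rintro ⟨z, z'⟩ hp
      obtain ⟨hz, hz'⟩ := Classical.not_imp.1 hp
      have h1 : merge (D ∪ (E : Set V)ᶜ) z z' ∈ B := by
        refine Eq.trans (Eq.symm ?_) hz
        refine eq_of_eqOn_compl_finset h (E.filter (· ∉ D)) (fun u hu => (Finset.mem_filter.1 hu).2)
          _ _ fun w hw => ?_
        have : w ∈ D ∪ (E : Set V)ᶜ := by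
          by_contra hc
          simp only [Set.mem_union, Set.mem_compl_iff, Finset.mem_coe, not_or, not_not] at hc
          exact hw (Finset.mem_filter.2 ⟨hc.2, hc.1⟩)
        simp [merge, this]
      have h2 : merge (D ∪ (E : Set V)ᶜ) z z' ∈ cylinder E S ↔ merge D z z' ∈ cylinder E S := by
        have : E.restrict (merge (D ∪ (E : Set V)ᶜ) z z') = E.restrict (merge D z z') := by
          ext w
          simp [merge]
        rw [mem_cylinder, mem_cylinder, this]
      by_cases hc : merge D z z' ∈ cylinder E S
      · exact Or.inr (Or.inl ⟨hc, hz'⟩)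
      · exact Or.inl (Or.inr ⟨h1, fun h' => hc (h2.1 h')⟩)
    have hm : ∀ R : Set V, (seedMeasure V).prod (seedMeasure V)
        ((fun p => merge R p.1 p.2) ⁻¹' (symmDiff (cylinder E S) B)) ≤ ε / 2 := fun R => by
      rw [(measurePreserving_merge R).measure_preimage (hCm.symmDiff (hf k)).nullMeasurableSet]
      exact hCB.le
    calc _ ≤ (ε / 2 : ℝ≥0∞) + ε / 2 :=
          (measure_mono hsub).trans ((measure_union_le _ _).trans (add_le_add (hm _) (hm _)))
      _ = 0 + ε := by rw [ENNReal.add_halves, zero_add]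
  filter_upwards [ae_all_iff.2 main] with p hp
  exact (hp _ rfl).symm

variable {f : (V → unitInterval) → K} {D : Set V}

theorem DependsAE.condEnt_inter (h : DependsAE f D) (R : Set V) :
    condEnt f (R ∩ D) = condEnt f R := by
  -- A third independent sample replaces the seeds off `D`; after that the configurations merged
  -- along `R` and along `R ∩ D` coincide.
  have key : ∀ R : Set V, ∀ᵐ q ∂((seedMeasure V).prod (seedMeasure V)).prod (seedMeasure V),
      f (merge R q.1.1 q.1.2) = f (merge D (merge R q.1.1 q.1.2) q.2) := fun R =>
    ((measurePreserving_merge R).prod (.id (seedMeasure V))).quasiMeasurePreserving.ae h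
  have h1 : ∀ᵐ q ∂((seedMeasure V).prod (seedMeasure V)).prod (seedMeasure V),
      f (merge (R ∩ D) q.1.1 q.1.2) = f (merge R q.1.1 q.1.2) := by
    filter_upwards [key R, key (R ∩ D)] with q hq hq'
    rw [hq, hq']
    congr 1
    ext v
    by_cases hv : v ∈ D <;> by_cases hR : v ∈ R <;> simp [merge, hv, hR]
  have h2 : ∀ᵐ p ∂(seedMeasure V).prod (seedMeasure V),
      f (merge (R ∩ D) p.1 p.2) = f (merge R p.1 p.2) := by
    filter_upwards [Measure.ae_ae_of_ae_prod h1] with p hp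
    simpa using hp
  refine integral_congr_ae ?_
  filter_upwards [Measure.ae_ae_of_ae_prod h2] with z hz
  have : condProb f (R ∩ D) z = condProb f R z := by
    ext k
    refine measureReal_congr ?_
    filter_upwards [hz] with z' hz'
    exact congrArg (· = k) hz'
  simp only [this]

theorem condEnt_univ (f : (V → unitInterval) → K) : condEnt f Set.univ = 0 := by
  have : ∀ z k, Real.negMulLog (condProb f Set.univ z k) = 0 := fun z k => by
    by_cases hk : f z = k <;> simp [condProb, hk]
  simp [condEnt, this]

theorem DependsAE.condEnt_self (h : DependsAE f D) : condEnt f D = 0 := by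
  rw [← condEnt_univ f, ← h.condEnt_inter Set.univ, Set.univ_inter]

theorem entropy_eq_condEnt_empty [Finite K] {Ω : Type*} [MeasurableSpace Ω] {P : Measure Ω}
    {Z : Ω → V → unitInterval} (hZ : Measurable Z) (hP : P.map Z = seedMeasure V)
    (hf : ∀ k, MeasurableSet (f ⁻¹' {k})) :
    entropy P (fun ω => f (Z ω)) = ENNReal.ofReal (condEnt f ∅) := by
  cases nonempty_fintype K
  have h1 : ∀ z k, condProb f ∅ z k = P.real ((fun ω => f (Z ω)) ⁻¹' {k}) := fun z k => by
    rw [condProb, ← hP, map_measureReal_apply hZ]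
    · simp [Set.preimage]
    · exact measurable_merge_right ∅ z (hf k)
  simp only [condEnt, h1, entropy, tsum_fintype, integral_const, probReal_univ, one_smul]
  rw [ENNReal.ofReal_sum_of_nonneg fun k _ => ?_]
  rw [← h1 (fun _ => 0)]
  exact Real.negMulLog_nonneg (condProb_nonneg _ _ _) (condProb_le_one _ _ _)

end Dependence

/-! ### Splitting entropy among the seeds along a random order. -/

section Information

variable {V K J : Type*}

/-- The mean conditional mutual information of `f` and the seed at `u`, given the seeds that
precede `u` in a uniformly random order of `V`. -/
def info (f : (V → unitInterval) → K) (u : V) : ℝ≥0∞ :=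
  ∫⁻ T, ENNReal.ofReal (condEnt f {w | T w < T u} - condEnt f (insert u {w | T w < T u}))
    ∂seedMeasure V

variable {f : (V → unitInterval) → K}

theorem info_comp_le [Finite K] [Finite J] (hf : ∀ k, MeasurableSet (f ⁻¹' {k})) (g : K → J)
    (u : V) : info (g ∘ f) u ≤ info f u :=
  lintegral_mono fun T => ENNReal.ofReal_le_ofReal <| by
    linarith [condEnt_sub_condEnt_comp_anti (Set.subset_insert u {w | T w < T u}) hf g]

theorem DependsAE.info_eq_zero {D : Set V} (h : DependsAE f D) {u : V} (hu : u ∉ D) :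
    info f u = 0 := by
  have : ∀ T : V → unitInterval,
      condEnt f {w | T w < T u} - condEnt f (insert u {w | T w < T u}) = 0 := fun T => by
    rw [← h.condEnt_inter (insert _ _), Set.insert_inter_of_notMem hu, h.condEnt_inter, sub_self]
  simp [info, this]

/-- With distinct clocks the points of `D` arrive one at a time. The last one, `a`, has all the
others in its past and lies in the past of none, so it can be split off by induction. -/
theorem sum_telescope_of_injOn {T : V → unitInterval} (φ : Set V → ℝ) (D : Finset V)
    (hT : Set.InjOn T D) :
    ∑ u ∈ D, (φ ({w | T w < T u} ∩ D) - φ (insert u {w | T w < T u} ∩ D)) = φ ∅ - φ D := by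
  classical
  induction D using Finset.induction_on_max_value T with
  | empty => simp
  | insert a D ha hmax ih =>
    have hlt : ∀ w ∈ D, T w < T a := fun w hw => (hmax w hw).lt_of_ne fun he =>
      ha (hT (by simp [hw]) (by simp) he ▸ hw)
    rw [Finset.sum_insert ha]
    have h1 : {w | T w < T a} ∩ ((insert a D : Finset V) : Set V) = D := by
      ext w
      simp only [Set.mem_inter_iff, Set.mem_ofPred_eq, Finset.coe_insert, Set.mem_insert_iff,
        Finset.mem_coe]
      constructor
      · rintro ⟨h, rfl | h'⟩
        · exact absurd h (lt_irrefl _)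
        · exact h'
      · exact fun h => ⟨hlt w h, Or.inr h⟩
    have h2 : insert a {w | T w < T a} ∩ ((insert a D : Finset V) : Set V) =
        ((insert a D : Finset V) : Set V) := by
      rw [Finset.coe_insert, ← Set.insert_inter_distrib]
      congr 1
      ext w
      simpa using hlt w
    have h3 : ∀ u ∈ D, φ ({w | T w < T u} ∩ ((insert a D : Finset V) : Set V)) -
        φ (insert u {w | T w < T u} ∩ ((insert a D : Finset V) : Set V)) =
        φ ({w | T w < T u} ∩ D) - φ (insert u {w | T w < T u} ∩ D) := fun u hu => by
      have hau : a ∉ insert u {w | T w < T u} := by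
        rintro (h | h)
        · exact ha (h ▸ hu)
        · exact (hlt u hu).not_gt h
      rw [Finset.coe_insert, Set.inter_insert_of_notMem fun h => hau (Or.inr h),
        Set.inter_insert_of_notMem hau]
    rw [h1, h2, Finset.sum_congr rfl h3, ih (hT.mono (by simp))]
    ring

theorem ae_injOn_seedMeasure (D : Finset V) : ∀ᵐ T ∂seedMeasure V, Set.InjOn T D := by
  have : ∀ p ∈ D ×ˢ D, ∀ᵐ T ∂seedMeasure V, p.1 ≠ p.2 → T p.1 ≠ T p.2 := by
    rintro ⟨v, w⟩ -
    by_cases hvw : v = w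
    · simp [hvw]
    have hmap := Measure.infinitePi_map_eval_prod (P := fun _ : V => (volume : Measure unitInterval))
      hvw
    have hd : ∀ᵐ q ∂(volume : Measure unitInterval).prod (volume : Measure unitInterval),
        q.1 ≠ q.2 := by
      rw [ae_iff]
      simp only [ne_eq, not_not]
      rw [Measure.measure_prod_null (measurableSet_eq_fun measurable_fst measurable_snd)]
      refine .of_forall fun x => ?_
      refine (congrArg volume ?_).trans (measure_singleton x)
      ext y
      simp [eq_comm]
    rw [← hmap] at hd
    filter_upwards [ae_of_ae_map (by fun_prop) hd] with T hT _ using hT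
  filter_upwards [(Finset.eventually_all _).2 this] with T hT v hv w hw hvw
  by_contra hne
  exact hT (v, w) (Finset.mem_product.2 ⟨hv, hw⟩) hne hvw

/-- The past of `u` within a finite `D` is determined by finitely many comparisons of clocks, so no
regularity of `φ` is needed. -/
theorem measurable_comp_setOf_lt_inter (φ : Set V → ℝ) (D : Finset V) (u : V) :
    Measurable fun T : V → unitInterval => φ ({w | T w < T u} ∩ D) := by
  have hq : Measurable fun (T : V → unitInterval) (w : D) => T w < T u :=
    measurable_pi_lambda _ fun w =>
      measurableSet_setOfPred.1 (measurableSet_lt (measurable_pi_apply _) (measurable_pi_apply _))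
  have h := (Measurable.of_discrete (f := fun q : D → Prop =>
    φ {w | ∃ h : w ∈ D, q ⟨w, h⟩})).comp hq
  convert h using 1
  ext T
  refine congrArg φ (Set.ext fun w => ?_)
  simp [and_comm]

/-- The total information of the seeds about `f` is the entropy of `f`. -/
theorem tsum_info [Finite K] (hf : ∀ k, MeasurableSet (f ⁻¹' {k})) {D : Finset V}
    (h : DependsAE f D) :
    ∑' u, info f u = ENNReal.ofReal (condEnt f ∅) := by
  classical
  have hinfo : ∀ u, info f u = ∫⁻ T, ENNReal.ofReal (condEnt f ({w | T w < T u} ∩ D) -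
      condEnt f (insert u {w | T w < T u} ∩ D)) ∂seedMeasure V := fun u => by
    simp only [info, h.condEnt_inter]
  have hmeas : ∀ u, Measurable fun T : V → unitInterval =>
      ENNReal.ofReal (condEnt f ({w | T w < T u} ∩ D) -
        condEnt f (insert u {w | T w < T u} ∩ D)) := fun u =>
by
    have h' := measurable_comp_setOf_lt_inter (fun A => condEnt f (insert u A ∩ D)) D u
    have hA : ∀ A : Set V, insert u (A ∩ D) ∩ D = insert u A ∩ (D : Set V) := fun A => by
      ext w; simp only [Set.mem_inter_iff, Set.mem_insert_iff]; tauto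
    simp only [hA] at h'
    exact ((measurable_comp_setOf_lt_inter (condEnt f) D u).sub h').ennreal_ofReal
  rw [tsum_eq_sum fun u hu => h.info_eq_zero (by simpa using hu),
    Finset.sum_congr rfl fun u _ => hinfo u, ← lintegral_finsetSum _ fun u _ => hmeas u]
  calc _ = ∫⁻ _, ENNReal.ofReal (condEnt f ∅) ∂seedMeasure V := by
        refine lintegral_congr_ae ?_
        filter_upwards [ae_injOn_seedMeasure D] with T hT
        rw [← ENNReal.ofReal_sum_of_nonneg fun u _ => sub_nonneg.2 (condEnt_anti
            (Set.inter_subset_inter_left _ (Set.subset_insert _ _)) hf),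
          sum_telescope_of_injOn _ D hT, h.condEnt_self, sub_zero]
    _ = _ := by simp

end Information

/-! ### Invariance under permutations of the seeds. -/

section Equivariance

variable {V K K' : Type*} (σ : Equiv.Perm V) {f : (V → unitInterval) → K}
  {f' : (V → unitInterval) → K'}

/-- Reindexing of configurations by a permutation. -/
def reindex : (V → unitInterval) ≃ᵐ (V → unitInterval) :=
  MeasurableEquiv.piCongrLeft (fun _ => unitInterval) σ.symm

theorem reindex_apply (z : V → unitInterval) : reindex σ z = z ∘ σ := by
  ext v
  have := Equiv.piCongrLeft_apply_apply (fun _ => unitInterval) σ.symm z (σ v)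
  simp only [Equiv.symm_apply_apply] at this
  exact congrArg _ this

theorem measurePreserving_reindex :
    MeasurePreserving (reindex σ) (seedMeasure V) (seedMeasure V) :=
  ⟨(reindex σ).measurable, Measure.infinitePi_map_piCongrLeft (fun _ => volume) σ.symm⟩

variable {σ} (e : K ≃ K') (h : ∀ z, f' z = e (f (z ∘ σ)))
include h

theorem condProb_equivariant (R : Set V) (z : V → unitInterval) (k : K) :
    condProb f' R z (e k) = condProb f (σ ⁻¹' R) (reindex σ z) k := by
  have : {z' | f' (merge R z z') = e k} =
      reindex σ ⁻¹' {z' | f (merge (σ ⁻¹' R) (reindex σ z) z') = k} := by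
    ext z'
    have : merge R z z' ∘ σ = merge (σ ⁻¹' R) (reindex σ z) (reindex σ z') := by
      ext v
      by_cases hR : σ v ∈ R <;> simp [merge, reindex_apply, hR]
    simp [h, this]
  rw [condProb, condProb, measureReal_def, this,
    (measurePreserving_reindex σ).measure_preimage_equiv, measureReal_def]

theorem condEnt_equivariant (R : Set V) : condEnt f' R = condEnt f (σ ⁻¹' R) := by
  have h1 : ∀ z, ∑' k, Real.negMulLog (condProb f' R z k) =
      ∑' k, Real.negMulLog (condProb f (σ ⁻¹' R) (reindex σ z) k) := fun z => by
    rw [← e.tsum_eq]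
    simp only [condProb_equivariant e h]
  simp only [condEnt, h1]
  exact (measurePreserving_reindex σ).integral_comp' (g := fun z =>
    ∑' k, Real.negMulLog (condProb f (σ ⁻¹' R) z k))

theorem info_equivariant (u : V) : info f' (σ u) = info f u := by
  have h1 : ∀ T : V → unitInterval,
      σ ⁻¹' insert (σ u) {w | T w < T (σ u)} =
        insert u {w | reindex σ T w < reindex σ T u} := fun T => by
    ext w
    simp [reindex_apply]
  have h2 : ∀ T : V → unitInterval,
      σ ⁻¹' {w | T w < T (σ u)} = {w | reindex σ T w < reindex σ T u} := fun T => by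
    ext w
    simp [reindex_apply]
  simp only [info, condEnt_equivariant e h, h1, h2]
  exact (measurePreserving_reindex σ).lintegral_comp_emb (reindex σ).measurableEmbedding
    (fun T => ENNReal.ofReal (condEnt f {w | T w < T u} - condEnt f (insert u {w | T w < T u})))

end Equivariance

/-! ### The level-set inequality behind the constant. -/

section Expansion

variable {V : Type*}

theorem expansion_mul_card_le (α : Set V → ℝ≥0) {W : V → Finset V} {u : V} {A : Finset V}
    (hA : A ⊆ W u) (hne : A.Nonempty) :
    expansion α W * A.card ≤
      ∑' U : {U : Set V // (U ∩ (A : Set V)).Nonempty}, (α U.1 : ℝ≥0∞) := by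
  rw [← ENNReal.le_div_iff_mul_le (by simp [hne.ne_empty]) (by simp)]
  exact iInf_le_of_le u (iInf_le_of_le A (iInf_le_of_le hA (iInf_le_of_le hne le_rfl)))

/-- Peel off the lowest layer: subtract `m = min a` from `a` on `A` and from `b U` for each `U`
meeting `A`. The layer is paid for by `expansion_mul_card_le`; the minimizer drops out, and the rest
is the induction hypothesis. Truncated subtraction loses nothing, as `m ≤ a v ≤ b U` for `v ∈ U ∩
A`. -/
theorem expansion_mul_sum_le (α : Set V → ℝ≥0) {W : V → Finset V} {u : V} (A : Finset V)
    (hA : A ⊆ W u) (a : V → ℝ≥0∞) (b : Set V → ℝ≥0∞) (hab : ∀ U, ∀ v ∈ U, v ∈ A → a v ≤ b U) :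
    expansion α W * ∑ v ∈ A, a v ≤ ∑' U, α U * b U := by
  classical
  induction A using Finset.strongInduction generalizing a b with
  | H A ih =>
    rcases A.eq_empty_or_nonempty with rfl | hne
    · simp
    obtain ⟨v₀, hv₀, hmin⟩ := A.exists_min_image a hne
    set m := a v₀
    let b' : Set V → ℝ≥0∞ := fun U => if (U ∩ (A : Set V)).Nonempty then b U - m else b U
    have h1 := ih (A.erase v₀) (Finset.erase_ssubset hv₀) ((Finset.erase_subset _ _).trans hA)
      (fun v => a v - m) b' fun U v hv hvA => by
        have hvA' := Finset.mem_of_mem_erase hvA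
        have hU : (U ∩ (A : Set V)).Nonempty := ⟨v, hv, hvA'⟩
        simp only [b', hU, if_true]
        exact tsub_le_tsub_right (hab U v hv hvA') m
    have h2 : ∑ v ∈ A, a v = A.card * m + ∑ v ∈ A.erase v₀, (a v - m) := by
      rw [Finset.sum_erase A (tsub_self m), ← nsmul_eq_mul, ← Finset.sum_const,
        ← Finset.sum_add_distrib]
      exact Finset.sum_congr rfl fun v hv => (add_tsub_cancel_of_le (hmin v hv)).symm
    have h3 : (∑' U : {U : Set V // (U ∩ (A : Set V)).Nonempty}, (α U.1 : ℝ≥0∞)) * m =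
        ∑' U : Set V, if (U ∩ (A : Set V)).Nonempty then (α U : ℝ≥0∞) * m else 0 := by
      rw [← ENNReal.tsum_mul_right]
      have := tsum_subtype {U : Set V | (U ∩ (A : Set V)).Nonempty}
        fun U => (α U : ℝ≥0∞) * m
      simp only [Set.indicator_apply, Set.mem_ofPred_eq] at this
      exact this
    calc expansion α W * ∑ v ∈ A, a v
        = expansion α W * A.card * m + expansion α W * ∑ v ∈ A.erase v₀, (a v - m) := by
          rw [h2, mul_add, mul_assoc]
      _ ≤ (∑' U : {U : Set V // (U ∩ (A : Set V)).Nonempty}, (α U.1 : ℝ≥0∞)) * m +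
          ∑' U, α U * b' U := by
          gcongr
          exact expansion_mul_card_le α hA hne
      _ = ∑' U : Set V, ((if (U ∩ (A : Set V)).Nonempty then (α U : ℝ≥0∞) * m else 0) +
          α U * b' U) := by rw [h3, ENNReal.tsum_add]
      _ ≤ ∑' U, α U * b U := by
          refine ENNReal.tsum_le_tsum fun U => ?_
          by_cases hU : (U ∩ (A : Set V)).Nonempty
          · simp only [b', hU, if_true]
            obtain ⟨v, hv, hvA⟩ := hU
            rw [← mul_add, add_tsub_cancel_of_le ((hmin v hvA).trans (hab U v hv hvA))]
          · simp [b', hU]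

end Expansion

/-! ### Sharing the weight of a set among its points. -/

section Weights

variable {V : Type*}

/-- Summing `α U / |U|` over the points of `U` gives back `α U`, for nonempty `U`. -/
theorem tsum_tsum_weight_div_ncard {α : Set V → ℝ≥0} (hα : ∀ U : Set V, α U ≠ 0 → U.Finite)
    {b : Set V → ℝ≥0∞} (hb : b ∅ = 0) :
    ∑' v, ∑' U : {U : Set V // v ∈ U}, (α U.1 : ℝ≥0∞) / (U.1.ncard : ℝ≥0∞) * b U.1 =
      ∑' U, α U * b U := by
  classical
  have h1 : ∀ v, ∑' U : {U : Set V // v ∈ U}, (α U.1 : ℝ≥0∞) / (U.1.ncard : ℝ≥0∞) * b U.1 =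
      ∑' U : Set V, U.indicator (fun _ => (α U : ℝ≥0∞) / (U.ncard : ℝ≥0∞) * b U) v := fun v => by
    have := tsum_subtype {U : Set V | v ∈ U}
      fun U => (α U : ℝ≥0∞) / (U.ncard : ℝ≥0∞) * b U
    simp only [Set.indicator_apply, Set.mem_ofPred_eq] at this ⊢
    exact this
  simp only [h1]
  rw [ENNReal.tsum_comm]
  refine tsum_congr fun U => ?_
  rcases U.eq_empty_or_nonempty with rfl | hne
  · simp [hb]
  by_cases h0 : α U = 0
  · simp [h0]
  have hfin := hα U h0
  have hc : (U.ncard : ℝ≥0∞) ≠ 0 := by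
    simpa [Set.ncard_eq_zero hfin] using hne.ne_empty
  rw [← tsum_subtype U, ENNReal.tsum_const, ENat.card_coe_set_eq, ← hfin.cast_ncard_eq]
  simp only [ENat.toENNReal_coe]
  rw [← mul_assoc, ENNReal.mul_div_cancel hc (ENNReal.natCast_ne_top _)]

end Weights

/-! ### Mass transport and finiteness of influence. -/

section Influence

variable {Γ V M : Type*} [Group Γ] [MulAction Γ V]

/-- The vertices whose labels are influenced by the seed at `u`. -/
def influence (F : (V → unitInterval) → (V → M)) (u : V) : Set V :=
  {v | ∃ z z' : V → unitInterval, (∀ w, w ≠ u → z w = z' w) ∧ F z v ≠ F z' v}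

variable {F : (V → unitInterval) → (V → M)}

theorem influence_subset {u : V} {A : Set V} (h : InfluencesOnly F u A) : influence F u ⊆ A := by
  rintro v ⟨z, z', hz, hne⟩
  by_contra hv
  exact hne (h z z' hz v hv)

/-- The sets `W u` need not be equivariant; these minimal ones are, so mass transport can be applied
to them. -/
theorem smul_mem_influence_smul (hF : ∀ (γ : Γ) z, F (shift γ z) = shift γ (F z)) (γ : Γ)
    {u v : V} (h : v ∈ influence F u) : γ • v ∈ influence F (γ • u) := by
  obtain ⟨z, z', hz, hne⟩ := h
  refine ⟨shift γ z, shift γ z', fun w hw => hz _ fun h => hw ?_, ?_⟩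
  · rw [← h, smul_inv_smul]
  · simpa [hF, shift] using hne

theorem smul_mem_influence_smul_iff (hF : ∀ (γ : Γ) z, F (shift γ z) = shift γ (F z)) (γ : Γ)
    {u v : V} : γ • v ∈ influence F (γ • u) ↔ v ∈ influence F u :=
  ⟨fun h => by simpa using smul_mem_influence_smul hF γ⁻¹ h, smul_mem_influence_smul hF γ⟩

variable [MeasurableSpace (MulAction.orbitRel.Quotient Γ V)]
    [DiscreteMeasurableSpace (MulAction.orbitRel.Quotient Γ V)]
    {μ : Measure (MulAction.orbitRel.Quotient Γ V)}

theorem MassTransportPrinciple.measure_singleton_ne_zero (hμ : MassTransportPrinciple μ)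
    (h0 : μ ≠ 0) (c : MulAction.orbitRel.Quotient Γ V) : μ {c} ≠ 0 := by
  classical
  intro hc
  let q : V → MulAction.orbitRel.Quotient Γ V := Quotient.mk _
  have hq : ∀ (γ : Γ) v, q (γ • v) = q v := fun γ v =>
    Quotient.sound (s := MulAction.orbitRel Γ V) ⟨γ, rfl⟩
  -- Every point sends mass 1 to each point of `c`. If `c` were null, the mean mass received would
  -- be 0, while each point sends out at least 1.
  have h := hμ (fun _ v => if q v = c then 1 else 0) fun γ u v => by simp only [hq]
  have h2 : orbitMean μ (fun o => ∑' _ : V, if q o = c then (1 : ℝ≥0∞) else 0) = 0 := by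
    rw [orbitMean, lintegral_eq_zero_iff .of_discrete]
    have : ∀ᵐ c' ∂μ, c' ≠ c := by rw [ae_iff]; simpa using hc
    filter_upwards [this] with c' hc'
    have : q c'.out ≠ c := by rwa [show q c'.out = c' from Quotient.out_eq c']
    simp [this]
  rw [h2] at h
  simp only [orbitMean, lintegral_const, mul_eq_zero, ENNReal.tsum_eq_zero,
    Measure.measure_univ_eq_zero, h0, or_false] at h
  simpa [show q c.out = c from Quotient.out_eq c] using h c.out

theorem MassTransportPrinciple.finite_setOf_mem_influence [IsFiniteMeasure μ]
    [Finite (MulAction.orbitRel.Quotient Γ V)] (hμ : MassTransportPrinciple μ) (h0 : μ ≠ 0)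
    (hF : ∀ (γ : Γ) z, F (shift γ z) = shift γ (F z)) (hfin : ∀ u, (influence F u).Finite)
    (v : V) : {u | v ∈ influence F u}.Finite := by
  classical
  cases nonempty_fintype (MulAction.orbitRel.Quotient Γ V)
  -- This equates the mean number of seeds influencing a label with the mean number of labels
  -- influenced by a seed, which is finite. As every orbit has positive mass, the former number is
  -- finite at each representative.
  have h := hμ (fun o u => if o ∈ influence F u then 1 else 0) fun γ u v => by
    simp only [smul_mem_influence_smul_iff hF]
  have hlt : orbitMean μ
      (fun o => ∑' u, if u ∈ influence F o then (1 : ℝ≥0∞) else 0) < ⊤ := by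
    rw [orbitMean, lintegral_fintype]
    refine ENNReal.sum_lt_top.2 fun c _ => ENNReal.mul_lt_top ?_ (measure_lt_top _ _)
    rw [tsum_eq_sum (s := (hfin c.out).toFinset) fun u hu => if_neg (by simpa using hu)]
    exact ENNReal.sum_lt_top.2 fun u _ => by split_ifs <;> simp
  rw [← h, orbitMean, lintegral_fintype, ENNReal.sum_lt_top] at hlt
  have hrep : ∀ c : MulAction.orbitRel.Quotient Γ V, {u | c.out ∈ influence F u}.Finite :=
    fun c => by
      have h1 : (∑' u, if c.out ∈ influence F u then (1 : ℝ≥0∞) else 0) ≠ ⊤ := fun ht => by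
        have := hlt c (Finset.mem_univ c)
        rw [ht, ENNReal.top_mul (hμ.measure_singleton_ne_zero h0 c)] at this
        exact lt_irrefl _ this
      refine (ENNReal.finite_const_le_of_tsum_ne_top h1 one_ne_zero).subset fun u hu => ?_
      have hu' : c.out ∈ influence F u := hu
      simp [hu']
  let c : MulAction.orbitRel.Quotient Γ V := Quotient.mk _ v
  have hrel : (MulAction.orbitRel Γ V) v c.out := Quotient.exact (Quotient.out_eq c).symm
  rw [MulAction.orbitRel_apply] at hrel
  obtain ⟨γ, hγ⟩ := hrel
  refine ((hrep c).image (γ • ·)).subset fun u hu => ⟨γ⁻¹ • u, ?_, smul_inv_smul γ u⟩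
  have hu' : γ • c.out ∈ influence F (γ • γ⁻¹ • u) := by
    rw [smul_inv_smul, show γ • c.out = v from hγ]; exact hu
  exact (smul_mem_influence_smul_iff hF γ).1 hu'

end Influence

/-! ### Information about the labels of a factor. -/

section Labels

variable {Γ V M : Type*} [Group Γ] [MulAction Γ V] {F : (V → unitInterval) → (V → M)}

/-- The labels that `F` gives to the vertices in `U`. -/
def restrictLabels (F : (V → unitInterval) → (V → M)) (U : Set V) (z : V → unitInterval) :
    U → M :=
  fun v => F z v

theorem measurableSet_restrictLabels_preimage [Countable V] [MeasurableSpace M]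
    [DiscreteMeasurableSpace M] (hF : Measurable F) (U : Set V) (k : U → M) :
    MeasurableSet (restrictLabels F U ⁻¹' {k}) := by
  have : restrictLabels F U ⁻¹' {k} = ⋂ v : U, (fun z => F z v) ⁻¹' {k v} := by
    ext z
    simp [restrictLabels, funext_iff]
  rw [this]
  exact .iInter fun v => (measurable_pi_iff.1 hF v) (.of_discrete)

theorem info_smul (hF : ∀ (γ : Γ) z, F (shift γ z) = shift γ (F z)) (γ : Γ) (u v : V) :
    info (fun z => F z (γ • v)) (γ • u) = info (fun z => F z v) u :=
  info_equivariant (σ := MulAction.toPerm γ) (Equiv.refl M) (fun z => by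
    have : z ∘ (MulAction.toPerm γ : Equiv.Perm V) = shift γ⁻¹ z := by ext; simp [shift]
    simp [this, hF, shift]) u

theorem info_restrictLabels_smul (hF : ∀ (γ : Γ) z, F (shift γ z) = shift γ (F z)) (γ : Γ) (u : V)
    (U : Set V) : info (restrictLabels F (γ • U)) (γ • u) = info (restrictLabels F U) u := by
  let ψ : U ≃ (γ • U : Set V) := (MulAction.toPerm γ : Equiv.Perm V).image U
  refine info_equivariant (σ := MulAction.toPerm γ) (ψ.arrowCongr (Equiv.refl M)) (fun z => ?_) u
  have : z ∘ (MulAction.toPerm γ : Equiv.Perm V) = shift γ⁻¹ z := by ext; simp [shift]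
  ext x
  obtain ⟨s, rfl⟩ := ψ.surjective x
  have hs : ((ψ s : (γ • U : Set V)) : V) = γ • (s : V) := rfl
  simp [this, hF, shift, restrictLabels, hs]

theorem dependsAE_restrictLabels [Finite M] [Countable V] [MeasurableSpace M]
    [DiscreteMeasurableSpace M] (hF : Measurable F) {U : Set V} (hU : U.Finite)
    (hfin : ∀ v, {u | v ∈ influence F u}.Finite) :
    ∃ D : Finset V, DependsAE (restrictLabels F U) D := by
  have : Finite U := hU
  refine ⟨(hU.biUnion fun v _ => hfin v).toFinset, dependsAE_of_not_influenced
    (measurableSet_restrictLabels_preimage hF U) fun u hu z z' hz => funext fun v => ?_⟩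
  by_contra hne
  exact hu (by simpa using ⟨v, v.2, z, z', hz, hne⟩)

end Labels

end EntropyExpansion

end

/-! ### The theorem: the inequality for one seed, averaged by mass transport. -/

open EntropyExpansion in
theorem theorem3p3
    {Γ V M Ω : Type*} [Group Γ] [MulAction Γ V] [Countable V]
    [Finite (MulAction.orbitRel.Quotient Γ V)]
    [MeasurableSpace (MulAction.orbitRel.Quotient Γ V)]
    [DiscreteMeasurableSpace (MulAction.orbitRel.Quotient Γ V)]
    (μ : Measure (MulAction.orbitRel.Quotient Γ V)) [IsFiniteMeasure μ]
    (hμ : EntropyExpansion.MassTransportPrinciple μ)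
    (α : Set V → ℝ≥0) (hα : EntropyExpansion.IsInvariantWeight Γ α)
    [MeasurableSpace Ω] (P : Measure Ω) [IsProbabilityMeasure P]
    (Z : V → Ω → unitInterval) (hZ : EntropyExpansion.IsIIDProcess P Z)
    [Finite M] [MeasurableSpace M] [DiscreteMeasurableSpace M]
    (F : (V → unitInterval) → (V → M)) (hF : EntropyExpansion.IsFactorMap Γ F)
    (X : V → Ω → M) (hX : ∀ v ω, X v ω = F (fun u => Z u ω) v)
    (W : V → Finset V)
    (hW : ∀ u, EntropyExpansion.InfluencesOnly F u (W u : Set V)) :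
    EntropyExpansion.orbitMean μ (fun o => ∑' U : {U : Set V // o ∈ U},
        ((α U.1 : ℝ≥0∞) / (U.1.ncard : ℝ≥0∞)) *
          EntropyExpansion.entropy P (fun ω (v : U.1) => X v ω))
      ≥ EntropyExpansion.expansion α W *
          EntropyExpansion.orbitMean μ (fun o => EntropyExpansion.entropy P (X o)) := by
  classical
  -- For `μ = 0` mass transport is vacuous and gives no finiteness, but both sides vanish.
  rcases eq_or_ne μ 0 with rfl | h0
  · simp [orbitMean]
  have hinfl : ∀ u, influence F u ⊆ W u := fun u => influence_subset (hW u)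
  have hfin := hμ.finite_setOf_mem_influence h0 hF.equivariant
    fun u => (W u).finite_toSet.subset (hinfl u)
  have hZm : Measurable fun ω u => Z u ω := measurable_pi_iff.2 hZ.measurable
  have hP : P.map (fun ω u => Z u ω) = seedMeasure V := by
    rw [hZ.indep.map_fun_eq_infinitePi_map hZ.measurable]
    simp only [hZ.uniform]
  have hlabel : ∀ v (k : M), MeasurableSet ((fun z => F z v) ⁻¹' {k}) := fun v k =>
    (measurable_pi_iff.1 hF.measurable v) .of_discrete
  have hset := measurableSet_restrictLabels_preimage hF.measurable
  have hlabel_dep : ∀ v, DependsAE (fun z => F z v) ((hfin v).toFinset : Set V) := fun v =>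
    dependsAE_of_not_influenced (hlabel v) fun u hu z z' hz => by
      by_contra hne
      exact hu (by simpa using ⟨z, z', hz, hne⟩)
  have hentropy : ∀ v, entropy P (X v) = ∑' u, info (fun z => F z v) u := fun v => by
    rw [tsum_info (hlabel v) (hlabel_dep v), ← entropy_eq_condEnt_empty hZm hP (hlabel v)]
    congr 1
    exact funext (hX v)
  have hentropy_set : ∀ U : Set V, U.Finite →
      entropy P (fun ω (v : U) => X v ω) = ∑' u, info (restrictLabels F U) u := fun U hU => by
    have : Finite U := hU
    obtain ⟨D, hD⟩ := dependsAE_restrictLabels hF.measurable hU hfin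
    rw [tsum_info (hset U) hD, ← entropy_eq_condEnt_empty hZm hP (hset U)]
    congr 1
    exact funext fun ω => funext fun v => hX v ω
  have hpoint : ∀ u, expansion α W * ∑' v, info (fun z => F z v) u ≤
      ∑' v, ∑' U : {U : Set V // v ∈ U},
        (α U.1 : ℝ≥0∞) / (U.1.ncard : ℝ≥0∞) * info (restrictLabels F U.1) u := fun u => by
    -- The value 0 at `∅` accounts for the term of `∅`, which contains no point. On infinite sets
    -- `α` vanishes, so `⊤` costs nothing and makes the comparison with `a` trivial.
    let b : Set V → ℝ≥0∞ := fun U =>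
      if U = ∅ then 0 else if U.Finite then info (restrictLabels F U) u else ⊤
    have hb : ∀ v (U : {U : Set V // v ∈ U}),
        (α U.1 : ℝ≥0∞) / (U.1.ncard : ℝ≥0∞) * info (restrictLabels F U.1) u =
          (α U.1 : ℝ≥0∞) / (U.1.ncard : ℝ≥0∞) * b U.1 := fun v U => by
      by_cases hU : α U.1 = 0
      · simp [hU]
      · simp [b, Set.Nonempty.ne_empty ⟨v, U.2⟩, hα.finite_of_ne_zero _ hU]
    simp only [hb]
    rw [tsum_tsum_weight_div_ncard hα.finite_of_ne_zero (if_pos rfl),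
      tsum_eq_sum (s := W u) fun v hv => (hlabel_dep v).info_eq_zero fun h =>
        hv (hinfl u (by simpa using h))]
    refine expansion_mul_sum_le α (W u) subset_rfl _ b fun U v hv _ => ?_
    simp only [b, if_neg (Set.Nonempty.ne_empty ⟨v, hv⟩)]
    split_ifs with hU
    · have : Finite U := hU
      exact info_comp_le (hset U) (fun x : U → M => x ⟨v, hv⟩) u
    · exact le_top
  -- The label side `o` sends to the seed `u` the information that `u` gives about the sets
  -- containing `o`. Summed over `u` this is entropy; summed over `o` it is the right side of
  -- `hpoint`.
  have htransport := hμ (fun o u => ∑' U : {U : Set V // o ∈ U},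
      (α U.1 : ℝ≥0∞) / (U.1.ncard : ℝ≥0∞) * info (restrictLabels F U.1) u) fun γ u v => by
    let ψ : {U : Set V // u ∈ U} ≃ {U : Set V // γ • u ∈ U} :=
      (MulAction.toPerm γ : Equiv.Perm (Set V)).subtypeEquiv fun U => by simp
    have hψ : ∀ U, (ψ U).1 = γ • U.1 := fun _ => rfl
    beta_reduce
    rw [← ψ.tsum_eq]
    simp only [hψ, hα.invariant, Set.ncard_smul_set]
    exact tsum_congr fun U => congrArg _ (info_restrictLabels_smul hF.equivariant γ v U.1)
  have htransport' := hμ (fun o u => info (fun z => F z o) u) fun γ u v =>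
    info_smul hF.equivariant γ v u
  calc expansion α W * orbitMean μ (fun o => entropy P (X o))
      = expansion α W * orbitMean μ (fun u => ∑' v, info (fun z => F z v) u) := by
        rw [← htransport']
        simp only [hentropy]
    _ = orbitMean μ (fun u => expansion α W * ∑' v, info (fun z => F z v) u) :=
        (lintegral_const_mul _ .of_discrete).symm
    _ ≤ orbitMean μ (fun u => ∑' v, ∑' U : {U : Set V // v ∈ U},
          (α U.1 : ℝ≥0∞) / (U.1.ncard : ℝ≥0∞) * info (restrictLabels F U.1) u) :=
        lintegral_mono fun c => hpoint _
    _ = orbitMean μ (fun o => ∑' U : {U : Set V // o ∈ U},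
          (α U.1 : ℝ≥0∞) / (U.1.ncard : ℝ≥0∞) * entropy P (fun ω (v : U.1) => X v ω)) := by
        rw [← htransport]
        refine congrArg (orbitMean μ) (funext fun o => ?_)
        rw [ENNReal.tsum_comm]
        refine tsum_congr fun U => ?_
        rw [ENNReal.tsum_mul_left]
        by_cases hU : α U.1 = 0
        · simp [hU]
        · rw [hentropy_set _ (hα.finite_of_ne_zero _ hU)]
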